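/- Let $n\ge 3$ and let $(W,S)$ be a Coxeter system of type $D_n$, with $S=\{s_1,\dots,s_n\}$ labelled so that the edges of the Coxeter graph are $\{s_1,s_3\}$ and $\{s_i,s_{i+1}\}$ for $2\le i\le n-1$ (all with label $3$). Then $W$ is finite. Let $\ell$ be the length function of $(W,S)$. For $J\subseteq S$ put $$X_J=\{w\in W:\ \ell(ws)>\ell(w)\text{ for all }s\in J\},\qquad x_J=\sum_{w\in X_J}w\in\mathbb{Q}W,$$ and set $x_j=x_{\{s_1,\dots,s_j\}}$ for $2\le j\le n$, $x_1=x_\emptyset$ and $x_0=2x_1$. Then, for all $1\le j,k\le n$, in the group algebra $\mathbb{Q}W$, $$x_j\,x_k=\sum_{l=0}^{\min(j,k)}\binom{n-j}{k-l}\binom{n-k}{j-l}\,(n-j-k+l)!\;2^{\,n-j-k+l}\;x_l ,$$ where a summand with $n-j-k+l<0$ is read as $0$ (its binomial coefficients vanish). In particular, for all $1\le j\le n$, $$x_j\,x_1=\frac{n!}{j!}\,2^{\,n-j}\,x_1 .$$ -/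

import Mathlib

open scoped Nat

noncomputable section

/-- The Coxeter matrix of type `D n`, with the generators labelled `s₁, …, sₙ` as in the diagram
```
          s₂
          |
    s₁ -- s₃ -- s₄ -- ⋯ -- sₙ
```
The element `i : Fin n` stands for the generator `sᵢ₊₁`. So the edges are `{0, 2}` and
`{i, i + 1}` for `1 ≤ i`. (The matrix `CoxeterMatrix.D` of Mathlib is not used, since its diagram
has an additional edge that joins the two end nodes of the fork.) -/
def coxeterMatrixD (n : ℕ) : CoxeterMatrix (Fin n) where
  M := Matrix.of fun i j : Fin n ↦
    if i = j then 1
    else if (1 ≤ (i : ℕ) ∧ (j : ℕ) = i + 1) ∨ (1 ≤ (j : ℕ) ∧ (i : ℕ) = j + 1) ∨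
        ((i : ℕ) = 0 ∧ (j : ℕ) = 2) ∨ ((j : ℕ) = 0 ∧ (i : ℕ) = 2) then 3
    else 2
  isSymm := by
    ext i j
    simp only [Matrix.transpose_apply, Matrix.of_apply, eq_comm (a := j) (b := i)]
    split_ifs <;> first | rfl | (exfalso; tauto)
  diagonal := by simp
  off_diagonal := by
    intro i j h
    simp only [Matrix.of_apply, if_neg h]
    split_ifs <;> norm_num

namespace CoxeterSystem

variable {B W : Type*} [Group W] {M : CoxeterMatrix B}

/-- `X_J = {w ∈ W : ℓ(w s) > ℓ(w) for all s ∈ J}`, the distinguished transversal of the left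
cosets of the parabolic subgroup `W_J`. The subset `J` of `S` is given by the labels of its
elements. -/
def leftTransversal (cs : CoxeterSystem M W) (J : Set B) : Set W :=
  {w | ∀ i ∈ J, cs.length w < cs.length (w * cs.simple i)}

/-- `x_J = ∑_{w ∈ X_J} w` in the group algebra `ℚ W`, for a finite Coxeter group `W`. -/
def descentElement (cs : CoxeterSystem M W) (J : Set B) : MonoidAlgebra ℚ W :=
  ∑ᶠ w ∈ cs.leftTransversal J, MonoidAlgebra.of ℚ W w

end CoxeterSystem

/-- The elements `x_j` in type `D n`: `x_j = x_J` with `J = {s₁, …, s_j}` for `2 ≤ j ≤ n`, while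
`x₁ = x_∅` (not `x_{s₁}`) and `x₀ = 2 x₁`. -/
def descentElementD {n : ℕ} {W : Type*} [Group W] (cs : CoxeterSystem (coxeterMatrixD n) W) :
    ℕ → MonoidAlgebra ℚ W
  | 0 => 2 * cs.descentElement ∅
  | 1 => cs.descentElement ∅
  | j + 2 => cs.descentElement {i : Fin n | (i : ℕ) < j + 2}

end

/-! The whole formula follows from multiplication by the single element X = x_{n-1}, for which X x_k
= 2(n-k) x_k + x_{k-1} when 1 ≤ k ≤ n (`descentElementD_pred_mul`). With P_m = x_{n-m}, this reads X
P_m = P_{m+1} + 2m P_m, and P_0 = x_n = 1. So P_m is the deformed falling factorial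
X(X-2)⋯(X-2(m-1)), and x_j x_k is a product of two such polynomials in X, expanded by
`fallingFactorial_mul_fallingFactorial`. The convention x_0 = 2x_1 makes the recursion hold at k =
1.

For the recursion, W acts on the 2n letters ±e_i by even signed permutations. Pairing with ρ = (0,
1, …, n-1) detects descents: ℓ(ws) > ℓ(w) iff w sends the simple root of s to a vector with positive
pairing (`length_lt_length_mul_simple_iff`). Hence, for k ≥ 2, w ∈ X_k means |w e_1| < w e_2 < ⋯ < w
e_k in terms of values. The coefficient of w in X x_k counts the u ∈ X_{n-1} with u⁻¹w ∈ X_k. Such u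
correspond to the letters u e_n (`transversalEquiv`), so p = w⁻¹u e_n runs over all letters. By
`mem_transversalD_iff_of_mul`, for k ≥ 2 each of the 2(n-k) letters ±e_i with i > k contributes [w ∈
X_k], the letter e_k contributes [w ∈ X_{k-1}], and all others contribute 0. -/

/-- Signed letters: `(i, ε)` stands for the signed basis vector `ε eᵢ`. -/
abbrev SignedLetter (n : ℕ) := Fin n × ℤˣ

/-! ### Reflections of the signed letters and their relations -/

namespace SignedLetter

variable {n : ℕ}

/-- The opposite letter. -/
def opp (p : SignedLetter n) : SignedLetter n := (p.1, -p.2)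

@[simp] lemma opp_opp (p : SignedLetter n) : p.opp.opp = p := by simp [opp]

@[simp] lemma fst_opp (p : SignedLetter n) : p.opp.1 = p.1 := rfl

lemma eq_or_eq_opp_of_fst_eq {p q : SignedLetter n} (h : p.1 = q.1) : p = q ∨ p = q.opp := by
  obtain ⟨i, ε⟩ := p
  obtain ⟨j, δ⟩ := q
  obtain rfl : i = j := h
  rcases Int.units_eq_one_or ε with rfl | rfl <;> rcases Int.units_eq_one_or δ with rfl | rfl <;>
    simp [opp]

/-- The reflection in the vector `q - p` as a function on the letters. -/
def reflectFun (p q x : SignedLetter n) : SignedLetter n :=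
  if x = p then q else if x = q then p else if x = p.opp then q.opp
  else if x = q.opp then p.opp else x

lemma ne_of_fst_ne {p q : SignedLetter n} (h : p.1 ≠ q.1) :
    p ≠ q ∧ p ≠ q.opp ∧ p.opp ≠ q ∧ p.opp ≠ q.opp :=
  ⟨fun e ↦ h (by rw [e]), fun e ↦ h (by rw [e, fst_opp]), fun e ↦ h (by rw [← e, fst_opp]),
    fun e ↦ h (by rw [← fst_opp p, e, fst_opp])⟩

lemma ne_opp (p : SignedLetter n) : p ≠ p.opp := fun e ↦ by
  have h := congrArg Prod.snd e
  rcases Int.units_eq_one_or p.2 with h' | h' <;> simp [opp, h'] at h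

section

variable {p q r s : SignedLetter n}

lemma reflectFun_left : reflectFun p q p = q := by simp [reflectFun]

lemma reflectFun_right : reflectFun p q q = p := by
  by_cases h : q = p
  · rw [h, reflectFun_left]
  · rw [reflectFun, if_neg h, if_pos rfl]

lemma reflectFun_opp (h : p.1 ≠ q.1) (x : SignedLetter n) :
    reflectFun p q x.opp = (reflectFun p q x).opp := by
  have := ne_of_fst_ne h
  have := ne_opp p
  have := ne_opp q
  have h1 := opp_opp x
  have h2 := opp_opp p
  have h3 := opp_opp q
  grind [reflectFun]

lemma reflectFun_of_ne {x : SignedLetter n} (hp : x.1 ≠ p.1) (hq : x.1 ≠ q.1) :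
    reflectFun p q x = x := by
  have := ne_of_fst_ne hp
  have := ne_of_fst_ne hq
  simp_all [reflectFun]

lemma reflectFun_involutive (h : p.1 ≠ q.1) : Function.Involutive (reflectFun p q) := by
  intro x
  have := ne_of_fst_ne h
  have := ne_opp p
  have := ne_opp q
  grind [reflectFun]

/-- The reflection in the vector `q - p` as a permutation of the letters. -/
def reflect (p q : SignedLetter n) (h : p.1 ≠ q.1) : Equiv.Perm (SignedLetter n) :=
  (reflectFun_involutive h).toPerm

lemma reflect_apply (h : p.1 ≠ q.1) (x : SignedLetter n) : reflect p q h x = reflectFun p q x := rfl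

lemma reflect_conj (g : Equiv.Perm (SignedLetter n)) (hg : ∀ x : SignedLetter n, g x.opp = (g x).opp)
    (h : p.1 ≠ q.1) (h' : (g p).1 ≠ (g q).1) :
    g * reflect p q h = reflect (g p) (g q) h' * g := by
  ext1 x
  simp only [Equiv.Perm.mul_apply, reflect_apply]
  have := g.injective
  simp only [reflectFun, ← hg, g.injective.eq_iff]
  split_ifs <;> rfl

lemma reflect_mul_self (h : p.1 ≠ q.1) : reflect p q h * reflect p q h = 1 := by
  ext1 x
  exact reflectFun_involutive h x

lemma reflect_mul_reflect_pow_two (h : p.1 ≠ q.1) (h' : r.1 ≠ s.1)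
    (hr : reflectFun p q r = r) (hs : reflectFun p q s = s) :
    (reflect p q h * reflect r s h') ^ 2 = 1 := by
  have hc := reflect_conj (reflect p q h) (reflectFun_opp h) h' (by
    simpa only [reflect_apply, hr, hs] using h')
  simp only [reflect_apply, hr, hs] at hc
  rw [pow_two, mul_assoc, ← mul_assoc (reflect r s h'), ← hc, mul_assoc, reflect_mul_self, mul_one,
    reflect_mul_self]

/-- The roots q - p and q + p are orthogonal, so each reflection fixes the other root up to sign.
This is the commutation of the two end nodes of the fork. -/
lemma reflect_mul_reflect_opp_pow_two (h : p.1 ≠ q.1) (h' : p.opp.1 ≠ q.1) :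
    (reflect p q h * reflect p.opp q h') ^ 2 = 1 := by
  have e1 : reflectFun p q p.opp = q.opp := by rw [reflectFun_opp h, reflectFun_left]
  have e2 : reflectFun p q q = p := reflectFun_right
  have hc := reflect_conj (reflect p q h) (reflectFun_opp h) h' (by
    simpa only [reflect_apply, e1, e2, fst_opp] using h.symm)
  have e3 : reflect (reflect p q h p.opp) (reflect p q h q) (by
      simpa only [reflect_apply, e1, e2, fst_opp] using h.symm) = reflect p.opp q h' := by
    ext1 x
    simp only [reflect_apply, e1, e2]
    have := ne_of_fst_ne h
    have := ne_opp p
    have := ne_opp q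
    have h2 := opp_opp p
    have h3 := opp_opp q
    grind [reflectFun]
  rw [e3] at hc
  rw [pow_two, mul_assoc, ← mul_assoc (reflect p.opp q h'), ← hc, mul_assoc, reflect_mul_self,
    mul_one, reflect_mul_self]

lemma reflect_mul_reflect_pow_three (h : p.1 ≠ q.1) (h' : q.1 ≠ r.1) (h'' : p.1 ≠ r.1) :
    (reflect p q h * reflect q r h') ^ 3 = 1 := by
  have e1 : reflectFun p q r = r := reflectFun_of_ne h''.symm h'.symm
  have e2 : reflectFun q r p = p := reflectFun_of_ne h h''
  have hc := reflect_conj (reflect p q h) (reflectFun_opp h) h' (by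
    simpa only [reflect_apply, e1, reflectFun_right] using h'')
  have hd := reflect_conj (reflect q r h') (reflectFun_opp h') h (by
    simpa only [reflect_apply, e2, reflectFun_left] using h'')
  simp only [reflect_apply, e1, e2, reflectFun_right, reflectFun_left] at hc hd
  have h1 := reflect_mul_self h
  have h2 := reflect_mul_self h'
  have hb : reflect p q h * reflect q r h' * reflect p q h =
      reflect q r h' * reflect p q h * reflect q r h' := by
    rw [hc, hd, mul_assoc, mul_assoc, h1, h2]
  calc (reflect p q h * reflect q r h') ^ 3
      = (reflect p q h * reflect q r h' * reflect p q h) * (reflect q r h' * reflect p q h *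
          reflect q r h') := by simp only [pow_succ, pow_zero, one_mul, mul_assoc]
    _ = reflect q r h' * reflect p q h * (reflect q r h' * reflect q r h') * reflect p q h *
          reflect q r h' := by rw [hb]; simp only [mul_assoc]
    _ = 1 := by rw [h2, mul_one, mul_assoc (reflect q r h'), h1, mul_one, h2]

end

/-- The pairing `⟨ρ, p⟩` with `ρ = (0, 1, …, n - 1)`. -/
def val (p : SignedLetter n) : ℤ := (p.2 : ℤ) * (p.1 : ℕ)

lemma val_opp (p : SignedLetter n) : p.opp.val = - p.val := by simp [opp, val]

end SignedLetter

/-! ### Simple roots and the Coxeter relations -/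

namespace SignedLetter

variable {n : ℕ}

/-- The simple root with label `i` is `target i - source i`; this is its `source`. -/
def source (i : Fin n) : SignedLetter n :=
  (⟨(i : ℕ) - 1, by omega⟩, if (i : ℕ) = 0 then -1 else 1)

/-- The simple root with label `i` is `target i - source i`; this is its `target`. -/
def target (hn : 3 ≤ n) (i : Fin n) : SignedLetter n :=
  (if (i : ℕ) = 0 then ⟨1, by omega⟩ else i, 1)

lemma source_fst_ne_target_fst (hn : 3 ≤ n) (i : Fin n) : (source i).1 ≠ (target hn i).1 := by
  simp only [source, target, ne_eq, Fin.ext_iff]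
  split_ifs
  · simp_all
  · omega

/-- Relative positions of two simple roots: consecutive along a shared letter (in either order), on
disjoint coordinates, or the fork pair e_2 + e_1, e_2 - e_1. -/
lemma simpleRoot_cases (hn : 3 ≤ n) {i j : Fin n} (h : i ≠ j) :
    (coxeterMatrixD n i j = 3 ∧ target hn i = source j ∧ (source i).1 ≠ (target hn j).1) ∨
    (coxeterMatrixD n i j = 3 ∧ target hn j = source i ∧ (source j).1 ≠ (target hn i).1) ∨
    (coxeterMatrixD n i j = 2 ∧ (source i).1 ≠ (source j).1 ∧ (source i).1 ≠ (target hn j).1 ∧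
      (target hn i).1 ≠ (source j).1 ∧ (target hn i).1 ≠ (target hn j).1) ∨
    (coxeterMatrixD n i j = 2 ∧ source i = (source j).opp ∧ target hn i = target hn j) := by
  obtain ⟨i, hi⟩ := i
  obtain ⟨j, hj⟩ := j
  have h' : i ≠ j := by simpa using h
  have e : coxeterMatrixD n ⟨i, hi⟩ ⟨j, hj⟩ = if (1 ≤ i ∧ j = i + 1) ∨ (1 ≤ j ∧ i = j + 1) ∨
      (i = 0 ∧ j = 2) ∨ (j = 0 ∧ i = 2) then 3 else 2 := by
    exact if_neg h
  rw [e]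
  simp only [source, target, opp, Prod.mk.injEq, ne_eq, Fin.ext_iff]
  rcases Nat.eq_zero_or_pos i with rfl | hi0 <;> rcases Nat.eq_zero_or_pos j with rfl | hj0
  · omega
  · simp only [if_true, if_neg hj0.ne']
    rcases (by omega : j = 1 ∨ j = 2 ∨ 3 ≤ j) with rfl | rfl | hj3
    · simp
    · simp
    · rw [if_neg (by omega)]
      simp
      omega
  · simp only [if_true, if_neg hi0.ne']
    rcases (by omega : i = 1 ∨ i = 2 ∨ 3 ≤ i) with rfl | rfl | hj3
    · simp
    · simp
    · rw [if_neg (by omega)]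
      simp
      omega
  · simp only [if_neg hi0.ne', if_neg hj0.ne', and_true]
    split_ifs <;> simp <;> omega

lemma simpleReflect_isLiftable (hn : 3 ≤ n) : (coxeterMatrixD n).IsLiftable
    fun i ↦ reflect (source i) (target hn i) (source_fst_ne_target_fst hn i) := by
  have key (p q r s : SignedLetter n) (h : p.1 ≠ q.1) (h' : r.1 ≠ s.1) (e : q = r)
      (h'' : p.1 ≠ s.1) : (reflect p q h * reflect r s h') ^ 3 = 1 := by
    subst e
    exact reflect_mul_reflect_pow_three h h' h''
  intro i j
  by_cases h : i = j
  · subst h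
    rw [(coxeterMatrixD n).diagonal, pow_one, reflect_mul_self]
  rcases simpleRoot_cases hn h with ⟨hM, h1, h2⟩ | ⟨hM, h1, h2⟩ | ⟨hM, h1, h2, h3, h4⟩ |
    ⟨hM, h1, h2⟩ <;> rw [hM]
  · exact key _ _ _ _ _ _ h1 h2
  · have h3 := key _ _ _ _ (source_fst_ne_target_fst hn j) (source_fst_ne_target_fst hn i) h1 h2
    set a := reflect (source j) (target hn j) (source_fst_ne_target_fst hn j)
    set b := reflect (source i) (target hn i) (source_fst_ne_target_fst hn i)
    rw [show b * a = a⁻¹ * (a * b) * a⁻¹⁻¹ by simp, conj_pow, h3]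
    group
  · exact reflect_mul_reflect_pow_two _ _ (reflectFun_of_ne h1.symm h3.symm)
      (reflectFun_of_ne h2.symm h4.symm)
  · have key' (p q r s : SignedLetter n) (h : p.1 ≠ q.1) (h' : r.1 ≠ s.1) (e : r = p.opp)
        (e' : s = q) : (reflect p q h * reflect r s h') ^ 2 = 1 := by
      subst e e'
      exact reflect_mul_reflect_opp_pow_two h h'
    exact key' _ _ _ _ _ _ (by rw [h1, opp_opp]) h2.symm

end SignedLetter

/-! ### The action on letters, root heights and the length function -/

namespace CoxeterSystem

open SignedLetter

variable {n : ℕ} {W : Type*} [Group W]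

/-- The action of the Coxeter group of type `D n` on the signed letters. -/
noncomputable def letterPerm (cs : CoxeterSystem (coxeterMatrixD n) W) (hn : 3 ≤ n) :
    W →* Equiv.Perm (SignedLetter n) :=
  cs.lift ⟨_, simpleReflect_isLiftable hn⟩

/-- The pairing of `ρ` with the image under `w` of the simple root with label `i`. -/
noncomputable def rootHeight (cs : CoxeterSystem (coxeterMatrixD n) W) (hn : 3 ≤ n) (w : W)
    (i : Fin n) : ℤ :=
  (cs.letterPerm hn w (target hn i)).val - (cs.letterPerm hn w (source i)).val

variable (cs : CoxeterSystem (coxeterMatrixD n) W) (hn : 3 ≤ n)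

lemma letterPerm_simple (i : Fin n) (p : SignedLetter n) :
    cs.letterPerm hn (cs.simple i) p = reflectFun (source i) (target hn i) p := by
  rw [letterPerm, lift_apply_simple]
  rfl

lemma letterPerm_opp (w : W) (p : SignedLetter n) :
    cs.letterPerm hn w p.opp = (cs.letterPerm hn w p).opp := by
  induction w using cs.simple_induction_left generalizing p with
  | one => simp
  | mul_simple_left w i ih =>
    rw [map_mul, Equiv.Perm.mul_apply, ih, letterPerm_simple,
      reflectFun_opp (source_fst_ne_target_fst hn i), ← cs.letterPerm_simple hn, Equiv.Perm.mul_apply]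

lemma letterPerm_fst_ne (w : W) {p q : SignedLetter n} (h : p.1 ≠ q.1) :
    (cs.letterPerm hn w p).1 ≠ (cs.letterPerm hn w q).1 := by
  intro e
  rcases eq_or_eq_opp_of_fst_eq e with e | e
  · exact h (by rw [(cs.letterPerm hn w).injective e])
  · rw [← letterPerm_opp] at e
    exact h (by rw [(cs.letterPerm hn w).injective e, fst_opp])

lemma rootHeight_one (i : Fin n) : 0 < cs.rootHeight hn 1 i := by
  simp only [rootHeight, map_one, Equiv.Perm.one_apply, val, source, target]
  split_ifs <;> simp <;> omega

lemma rootHeight_mul_simple_self (w : W) (i : Fin n) :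
    cs.rootHeight hn (w * cs.simple i) i = - cs.rootHeight hn w i := by
  simp only [rootHeight, map_mul, Equiv.Perm.mul_apply, letterPerm_simple, reflectFun_left,
    reflectFun_right]
  ring

lemma rootHeight_mul_simple_of_eq_two (w : W) {i j : Fin n} (h : coxeterMatrixD n i j = 2) :
    cs.rootHeight hn (w * cs.simple j) i = cs.rootHeight hn w i := by
  have hij : i ≠ j := by
    rintro rfl
    simp at h
  simp only [rootHeight, map_mul, Equiv.Perm.mul_apply, letterPerm_simple]
  rcases simpleRoot_cases hn hij with ⟨hM, -⟩ | ⟨hM, -⟩ | ⟨-, h1, h2, h3, h4⟩ | ⟨-, h1, h2⟩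
  · omega
  · omega
  · rw [reflectFun_of_ne h1 h2, reflectFun_of_ne h3 h4]
  · rw [h1, h2, reflectFun_opp (source_fst_ne_target_fst hn j), reflectFun_right, reflectFun_left,
      letterPerm_opp, letterPerm_opp, val_opp, val_opp]
    ring

lemma rootHeight_mul_simple_of_eq_three (w : W) {i j : Fin n} (h : coxeterMatrixD n i j = 3) :
    cs.rootHeight hn (w * cs.simple j) i = cs.rootHeight hn w i + cs.rootHeight hn w j := by
  have hij : i ≠ j := by
    rintro rfl
    simp at h
  simp only [rootHeight, map_mul, Equiv.Perm.mul_apply, letterPerm_simple]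
  rcases simpleRoot_cases hn hij with ⟨-, h1, h2⟩ | ⟨-, h1, h2⟩ | ⟨hM, -⟩ | ⟨hM, -⟩
  · rw [h1, reflectFun_left, reflectFun_of_ne (by
      rw [← h1]; exact source_fst_ne_target_fst hn i) h2]
    ring
  · rw [← h1, reflectFun_right, reflectFun_of_ne h2.symm (by
      rw [h1]; exact (source_fst_ne_target_fst hn i).symm)]
    ring
  · omega
  · omega

/-- The usual argument that ℓ(ws) > ℓ(w) keeps the simple root positive: induction on length, with a
reduction to the rank two subgroup generated by s_i and a right descent s_j of w. -/
lemma rootHeight_pos_of_length_lt (w : W) (i : Fin n)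
    (h : cs.length w < cs.length (w * cs.simple i)) : 0 < cs.rootHeight hn w i := by
  induction hl : cs.length w using Nat.strong_induction_on generalizing w i with
  | _ l ih =>
  subst hl
  by_cases hw : w = 1
  · subst hw
    exact cs.rootHeight_one hn i
  obtain ⟨j, hj⟩ := cs.exists_rightDescent_of_ne_one hw
  rw [isRightDescent_iff] at hj
  obtain ⟨v, rfl⟩ : ∃ v, w = v * cs.simple j := ⟨w * cs.simple j, by simp⟩
  rw [cs.simple_mul_simple_cancel_right] at hj
  have hij : i ≠ j := by
    rintro rfl
    rw [cs.simple_mul_simple_cancel_right] at h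
    omega
  have hM : coxeterMatrixD n i j = 2 ∨ coxeterMatrixD n i j = 3 := by
    rcases simpleRoot_cases hn hij with ⟨h, -⟩ | ⟨h, -⟩ | ⟨h, -⟩ | ⟨h, -⟩ <;> simp [h]
  have hrel := cs.simple_mul_simple_pow i j
  rcases hM with hM | hM
  · have hcomm : cs.simple j * cs.simple i = cs.simple i * cs.simple j := by
      rw [hM, pow_two, mul_assoc, ← mul_assoc (cs.simple j)] at hrel
      have := congrArg (fun x ↦ cs.simple i * x * cs.simple j) hrel
      simpa [mul_assoc] using this
    rw [rootHeight_mul_simple_of_eq_two _ _ _ hM]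
    refine ih _ (by omega) _ _ ?_ rfl
    rw [mul_assoc, hcomm, ← mul_assoc] at h
    rcases cs.length_mul_simple (v * cs.simple i) j with h1 | h1 <;> omega
  · have hbraid : cs.simple i * cs.simple j * cs.simple i =
        cs.simple j * cs.simple i * cs.simple j := by
      have := congrArg (fun x ↦ x * (cs.simple j * cs.simple i * cs.simple j)) hrel
      rw [hM] at this
      simpa [pow_succ, mul_assoc] using this
    rw [rootHeight_mul_simple_of_eq_three _ _ _ hM]
    have hvj := ih _ (by omega) v j (by omega) rfl
    rcases cs.length_mul_simple v i with h1 | h1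
    · have hvi := ih _ (by omega) v i (by omega) rfl
      omega
    · obtain ⟨u, rfl⟩ : ∃ u, v = u * cs.simple i := ⟨v * cs.simple i, by simp⟩
      rw [cs.simple_mul_simple_cancel_right] at h1
      rw [rootHeight_mul_simple_self, rootHeight_mul_simple_of_eq_three cs hn u
        ((coxeterMatrixD n).symmetric j i ▸ hM)]
      have hb : u * cs.simple i * cs.simple j * cs.simple i =
          u * cs.simple j * cs.simple i * cs.simple j := by
        simpa only [mul_assoc] using congrArg (u * ·) hbraid
      -- Here w = u s_i s_j, so w sends α_i to u α_j. Since w s_i = u s_j s_i s_j has length ℓ(u) +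
      -- 3, the factor s_j must lengthen u.
      have huj := ih _ (by omega) u j (by
        rw [hb] at h
        rcases cs.length_mul_simple (u * cs.simple j) i with h2 | h2 <;>
        rcases cs.length_mul_simple (u * cs.simple j * cs.simple i) j with h3 | h3 <;>
        rcases cs.length_mul_simple u j with h4 | h4 <;> omega) rfl
      omega

/-- The converse comes from applying the previous implication to w s_i, where the height changes
sign. -/
lemma length_lt_length_mul_simple_iff (w : W) (i : Fin n) :
    cs.length w < cs.length (w * cs.simple i) ↔ 0 < cs.rootHeight hn w i := by
  refine ⟨cs.rootHeight_pos_of_length_lt hn w i, fun h ↦ ?_⟩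
  by_contra h'
  have := cs.length_mul_simple_ne w i
  have := cs.rootHeight_pos_of_length_lt hn (w * cs.simple i) i (by
    rw [cs.simple_mul_simple_cancel_right]
    omega)
  rw [rootHeight_mul_simple_self] at this
  omega

lemma eq_one_of_rootHeight_pos {w : W} (h : ∀ i, 0 < cs.rootHeight hn w i) : w = 1 := by
  by_contra hw
  obtain ⟨i, hi⟩ := cs.exists_rightDescent_of_ne_one hw
  exact absurd ((cs.length_lt_length_mul_simple_iff hn w i).2 (h i)) (not_lt_of_gt hi)

/-- An element acting trivially has the same positive heights as 1, hence no right descent. -/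
lemma letterPerm_injective : Function.Injective (cs.letterPerm hn) := by
  rw [injective_iff_map_eq_one]
  intro w hw
  refine cs.eq_one_of_rootHeight_pos hn fun i ↦ ?_
  have := cs.rootHeight_one hn i
  simpa only [rootHeight, hw, map_one] using this

include cs hn in
lemma finite_of_coxeterMatrixD : Finite W :=
  Finite.of_injective _ (cs.letterPerm_injective hn)

lemma mem_leftTransversal_iff {J : Set (Fin n)} {w : W} :
    w ∈ cs.leftTransversal J ↔ ∀ i ∈ J, 0 < cs.rootHeight hn w i := by
  simp only [leftTransversal, Set.mem_ofPred_eq, cs.length_lt_length_mul_simple_iff hn]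

end CoxeterSystem

/-! ### Minimal coset representatives and the letter `top` -/

namespace SignedLetter

variable {n : ℕ}

/-- The signed letter `eₙ`. -/
def top (hn : 3 ≤ n) : SignedLetter n := (⟨n - 1, by omega⟩, 1)

lemma val_lt_val_top (hn : 3 ≤ n) {p : SignedLetter n} (h : p.1 ≠ (top hn).1) :
    p.val < (top hn).val := by
  have h' : (p.1 : ℕ) ≠ n - 1 := fun e ↦ h (Fin.ext e)
  have := p.1.2
  rcases Int.units_eq_one_or p.2 with h2 | h2 <;> simp [val, top, h2] <;> omega

lemma val_ne_val {p q : SignedLetter n} (h : p.1 ≠ q.1) : p.val ≠ q.val := by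
  have h' : (p.1 : ℕ) ≠ q.1 := fun e ↦ h (Fin.ext e)
  rcases Int.units_eq_one_or p.2 with h2 | h2 <;> rcases Int.units_eq_one_or q.2 with h3 | h3 <;>
    simp [val, h2, h3] <;> omega

lemma source_of_ne_zero {i : Fin n} (hi : (i : ℕ) ≠ 0) :
    source i = (⟨(i : ℕ) - 1, by omega⟩, 1) := by
  simp [source, hi]

lemma target_of_ne_zero (hn : 3 ≤ n) {i : Fin n} (hi : (i : ℕ) ≠ 0) : target hn i = (i, 1) := by
  simp [target, hi]

lemma source_zero (h : 0 < n) : source (⟨0, h⟩ : Fin n) = opp (⟨0, h⟩, 1) := by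
  simp [source, opp]

lemma target_zero (hn : 3 ≤ n) (h : 0 < n) :
    target hn (⟨0, h⟩ : Fin n) = (⟨1, by omega⟩, 1) := by
  simp [target]

end SignedLetter

namespace CoxeterSystem

open SignedLetter

variable {n : ℕ} {W : Type*} [Group W]
variable (cs : CoxeterSystem (coxeterMatrixD n) W) (hn : 3 ≤ n)

lemma rootHeight_pos_iff {w : W} {i : Fin n} : 0 < cs.rootHeight hn w i ↔
    (cs.letterPerm hn w (source i)).val < (cs.letterPerm hn w (target hn i)).val := by
  rw [rootHeight, sub_pos]

/-- The transversal whose sum is `x_k`, for `1 ≤ k`. -/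
def transversalD (cs : CoxeterSystem (coxeterMatrixD n) W) (k : ℕ) : Set W :=
  cs.leftTransversal {i : Fin n | 2 ≤ k ∧ (i : ℕ) < k}

lemma mem_transversalD_iff {k : ℕ} {w : W} : w ∈ cs.transversalD k ↔
    ∀ i : Fin n, 2 ≤ k → (i : ℕ) < k →
      (cs.letterPerm hn w (source i)).val < (cs.letterPerm hn w (target hn i)).val := by
  simp only [transversalD, cs.mem_leftTransversal_iff hn, Set.mem_ofPred_eq, rootHeight_pos_iff,
    and_imp]

lemma mem_transversalD_one {w : W} : w ∈ cs.transversalD 1 := by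
  simp [transversalD, leftTransversal]

section

variable {cs}

/-- The roots e_2 + e_1 and e_2 - e_1 together give the absolute value at the bottom; the remaining
roots propagate the chain upwards. -/
lemma abs_val_lt_of_mem_transversalD {k : ℕ} (hk2 : 2 ≤ k) (hk : k ≤ n) {u : W}
    (hu : u ∈ cs.transversalD k) (j : ℕ) (hj : j < k) (i : ℕ) (hi : i < j) :
    |(cs.letterPerm hn u (⟨i, by omega⟩, 1)).val| < (cs.letterPerm hn u (⟨j, by omega⟩, 1)).val := by
  rw [mem_transversalD_iff cs hn] at hu
  induction j generalizing i with
  | zero => omega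
  | succ j ih =>
    have h1 := hu ⟨j + 1, by omega⟩ hk2 hj
    rw [source_of_ne_zero (by simp), target_of_ne_zero hn (by simp)] at h1
    simp only [Nat.add_sub_cancel] at h1
    rcases Nat.eq_zero_or_pos j with rfl | hj0
    · obtain rfl : i = 0 := by omega
      have h0 := hu ⟨0, by omega⟩ hk2 (by dsimp only; omega)
      rw [source_zero, target_zero, letterPerm_opp, val_opp] at h0
      rw [abs_lt]
      exact ⟨by linarith, h1⟩
    · rcases (by omega : i = j ∨ i < j) with rfl | hij
      · have := ih (by omega) 0 hj0
        have := abs_nonneg (cs.letterPerm hn u (⟨0, by omega⟩, 1)).val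
        rw [abs_of_pos (by linarith)]
        exact h1
      · exact (ih (by omega) i hij).trans h1

lemma val_letterPerm (w : W) (p : SignedLetter n) :
    (cs.letterPerm hn w p).val = p.2 * (cs.letterPerm hn w (p.1, 1)).val := by
  obtain ⟨i, ε⟩ := p
  rcases Int.units_eq_one_or ε with rfl | rfl
  · simp
  · have := letterPerm_opp cs hn w (i, 1)
    simp only [opp] at this
    rw [this]
    have := val_opp (cs.letterPerm hn w (i, 1))
    simp only [opp] at this
    simp [this]

/-- By the chain of inequalities, u preserves the order of the letters other than ±e_n; hence v and
u * v order two letters alike unless v sends one of them to ±e_n. -/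
lemma val_lt_val_of_mem_transversalD {u : W} (hu : u ∈ cs.transversalD (n - 1))
    {q r : SignedLetter n} (hqr : q.1 ≠ r.1) (hq : q.1 ≠ (top hn).1) (hr : r.1 ≠ (top hn).1)
    (h : q.val < r.val) : (cs.letterPerm hn u q).val < (cs.letterPerm hn u r).val := by
  obtain ⟨⟨i, hi⟩, ε⟩ := q
  obtain ⟨⟨j, hj⟩, δ⟩ := r
  simp only [top, ne_eq, Fin.mk.injEq] at hqr hq hr
  rw [val_letterPerm, val_letterPerm hn u (⟨j, hj⟩, δ)]
  rcases lt_or_gt_of_ne hqr with hij | hij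
  · have := abs_lt.1 (abs_val_lt_of_mem_transversalD hn (by omega) (by omega) hu j (by omega) i hij)
    rcases Int.units_eq_one_or ε with rfl | rfl <;> rcases Int.units_eq_one_or δ with rfl | rfl <;>
      simp only [val] at h <;> simp at h ⊢ <;> omega
  · have := abs_lt.1 (abs_val_lt_of_mem_transversalD hn (by omega) (by omega) hu i (by omega) j hij)
    rcases Int.units_eq_one_or ε with rfl | rfl <;> rcases Int.units_eq_one_or δ with rfl | rfl <;>
      simp only [val] at h <;> simp at h ⊢ <;> omega

lemma val_lt_val_iff_of_mem_transversalD {u : W} (hu : u ∈ cs.transversalD (n - 1))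
    {q r : SignedLetter n} (hqr : q.1 ≠ r.1) (hq : q.1 ≠ (top hn).1) (hr : r.1 ≠ (top hn).1) :
    (cs.letterPerm hn u q).val < (cs.letterPerm hn u r).val ↔ q.val < r.val := by
  refine ⟨fun h ↦ ?_, val_lt_val_of_mem_transversalD hn hu hqr hq hr⟩
  rcases lt_or_gt_of_ne (val_ne_val hqr) with h' | h'
  · exact h'
  · exact absurd h (val_lt_val_of_mem_transversalD hn hu hqr.symm hr hq h').not_gt

lemma val_letterPerm_mul_lt_iff {u v : W} (hu : u ∈ cs.transversalD (n - 1))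
    {p q r : SignedLetter n} (hp : cs.letterPerm hn v p = top hn) (hqr : q.1 ≠ r.1)
    (hq : q.1 ≠ p.1) (hr : r.1 ≠ p.1) :
    (cs.letterPerm hn (u * v) q).val < (cs.letterPerm hn (u * v) r).val ↔
      (cs.letterPerm hn v q).val < (cs.letterPerm hn v r).val := by
  rw [map_mul, Equiv.Perm.mul_apply, Equiv.Perm.mul_apply]
  exact val_lt_val_iff_of_mem_transversalD hn hu (letterPerm_fst_ne cs hn v hqr)
    (hp ▸ letterPerm_fst_ne cs hn v hq) (hp ▸ letterPerm_fst_ne cs hn v hr)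

lemma val_letterPerm_lt {v : W} {p q : SignedLetter n} (hp : cs.letterPerm hn v p = top hn)
    (hq : q.1 ≠ p.1) : (cs.letterPerm hn v q).val < (cs.letterPerm hn v p).val := by
  rw [hp]
  exact val_lt_val_top hn (hp ▸ letterPerm_fst_ne cs hn v hq)

lemma val_letterPerm_opp_lt {v : W} {p q : SignedLetter n} (hp : cs.letterPerm hn v p = top hn)
    (hq : q.1 ≠ p.1) : (cs.letterPerm hn v p.opp).val < (cs.letterPerm hn v q).val := by
  have := val_letterPerm_lt hn hp (q := q.opp) hq
  rw [letterPerm_opp, val_opp] at this ⊢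
  linarith

/-- Removing the minimal coset representative `u` from the left of `u * v` turns the condition for
`v` into a condition for `u * v` and the letter `p` that `v` sends to `eₙ`. -/
lemma mem_transversalD_iff_of_mul {u v : W} (hu : u ∈ cs.transversalD (n - 1))
    {p : SignedLetter n} (hp : cs.letterPerm hn v p = top hn) {k : ℕ} (hk2 : 2 ≤ k) (hk : k ≤ n) :
    v ∈ cs.transversalD k ↔ (k ≤ (p.1 : ℕ) ∧ u * v ∈ cs.transversalD k) ∨
      (p = (⟨k - 1, by omega⟩, 1) ∧ u * v ∈ cs.transversalD (k - 1)) := by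
  obtain ⟨⟨m, hm⟩, ε⟩ := p
  have hcmp : ∀ i : Fin n, (source i).1 ≠ ⟨m, hm⟩ → (target hn i).1 ≠ ⟨m, hm⟩ →
      ((cs.letterPerm hn (u * v) (source i)).val < (cs.letterPerm hn (u * v) (target hn i)).val ↔
        (cs.letterPerm hn v (source i)).val < (cs.letterPerm hn v (target hn i)).val) :=
    fun i ↦ val_letterPerm_mul_lt_iff hn hu hp (source_fst_ne_target_fst hn i)
  have hsm : ∀ i : Fin n, (i : ℕ) ≤ m → 1 ≤ m → (source i).1 ≠ ⟨m, hm⟩ := by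
    intro i hi hm1
    simp only [source, ne_eq, Fin.mk.injEq]
    omega
  have htm : ∀ i : Fin n, (i : ℕ) < m → 2 ≤ m → (target hn i).1 ≠ ⟨m, hm⟩ := by
    intro i hi hm2
    simp only [target, ne_eq, Fin.ext_iff, apply_ite Fin.val]
    split_ifs <;> omega
  simp only [Prod.mk.injEq, Fin.mk.injEq]
  -- Either p is among ±e_1, …, ±e_k, or no root in the condition involves p and the orders for v
  -- and u * v agree.
  rcases Nat.lt_or_ge m k with hmk | hmk
  · have e1 : ¬ k ≤ m := by omega
    simp only [e1, false_and, false_or]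
    constructor
    · intro hv
      rw [mem_transversalD_iff cs hn] at hv
      -- A negative sign would give the positive letter the least value under v, against the chain
      -- for v.
      have hε : ε = 1 := by
        refine (Int.units_eq_one_or ε).resolve_right ?_
        rintro rfl
        rcases Nat.eq_zero_or_pos m with rfl | hm0
        · have h0 := hv ⟨0, hm⟩ hk2 (by omega)
          rw [target_zero, source_zero] at h0
          have := val_letterPerm_lt hn hp (q := (⟨1, by omega⟩, 1)) (by simp)
          exact absurd h0 this.not_gt
        · have h0 := hv ⟨m, hm⟩ hk2 hmk
          rw [target_of_ne_zero hn (by simpa using hm0.ne')] at h0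
          have := val_letterPerm_opp_lt hn hp (q := source ⟨m, hm⟩) (hsm ⟨m, hm⟩ le_rfl hm0)
          simp only [opp, neg_neg] at this
          exact absurd h0 this.not_gt
      subst hε
      -- The letter sent to the maximum e_n can only be the last in the chain.
      have hmk' : m = k - 1 := by
        by_contra hne
        have h0 := hv ⟨m + 1, by omega⟩ hk2 (by dsimp only; omega)
        rw [target_of_ne_zero hn (by simp), source_of_ne_zero (by simp)] at h0
        simp only [Nat.add_sub_cancel] at h0
        exact absurd h0 (val_letterPerm_lt hn hp (q := (⟨m + 1, by omega⟩, 1)) (by simp)).not_gt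
      refine ⟨⟨hmk', rfl⟩, ?_⟩
      rw [mem_transversalD_iff cs hn]
      intro i hk3 hi
      rw [hcmp i (hsm i (by omega) (by omega)) (htm i (by omega) (by omega))]
      exact hv i hk2 (by omega)
    · rintro ⟨⟨rfl, rfl⟩, hw⟩
      rw [mem_transversalD_iff cs hn] at hw ⊢
      intro i _ hi
      by_cases ht : (target hn i).1 = ⟨k - 1, hm⟩
      · have ht' : target hn i = (⟨k - 1, hm⟩, 1) := Prod.ext ht rfl
        rw [ht']
        exact val_letterPerm_lt hn hp (hsm i (by omega) (by omega))
      · rw [← hcmp i (hsm i (by omega) (by omega)) ht]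
        refine hw i ?_ ?_
        all_goals
          simp only [target, Fin.ext_iff, apply_ite Fin.val] at ht
          split_ifs at ht <;> omega
  · have e1 : ¬ m = k - 1 := by omega
    simp only [hmk, e1, false_and, or_false, true_and]
    rw [mem_transversalD_iff cs hn, mem_transversalD_iff cs hn]
    refine forall_congr' fun i ↦ forall_congr' fun _ ↦ forall_congr' fun hi ↦ ?_
    rw [hcmp i (hsm i (by omega) (by omega)) (htm i (by omega) (by omega))]

/-- If u' = u v, then v fixes e_n, and the criterion with k = n puts v in X_n = {1}. -/
lemma eq_of_letterPerm_top_eq {u u' : W} (hu : u ∈ cs.transversalD (n - 1))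
    (hu' : u' ∈ cs.transversalD (n - 1))
    (h : cs.letterPerm hn u (top hn) = cs.letterPerm hn u' (top hn)) : u = u' := by
  obtain ⟨v, rfl⟩ : ∃ v, u' = u * v := ⟨u⁻¹ * u', by simp⟩
  rw [map_mul, Equiv.Perm.mul_apply] at h
  have hv := ((cs.letterPerm hn u).injective h).symm
  suffices v = 1 by rw [this, mul_one]
  refine cs.eq_one_of_rootHeight_pos hn fun i ↦ ?_
  have : v ∈ cs.transversalD n :=
    (mem_transversalD_iff_of_mul hn hu hv (by omega) le_rfl).2 (Or.inr ⟨rfl, hu'⟩)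
  rw [rootHeight_pos_iff]
  exact (mem_transversalD_iff cs hn).1 this i (by omega) i.2

variable (cs)

/-- The simple reflections walk e_n down to e_2, then to e_1 or, through the fork, to -e_1, and from
there on to -e_n. -/
lemma exists_letterPerm_top_eq (p : SignedLetter n) : ∃ w, cs.letterPerm hn w (top hn) = p := by
  have step (i : Fin n) (p : SignedLetter n) (h : ∃ w, cs.letterPerm hn w (top hn) = p) :
      ∃ w, cs.letterPerm hn w (top hn) = reflectFun (source i) (target hn i) p := by
    obtain ⟨w, rfl⟩ := h
    exact ⟨cs.simple i * w, by rw [map_mul, Equiv.Perm.mul_apply, letterPerm_simple]⟩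
  have pos : ∀ d m : ℕ, ∀ h : m + d = n - 1,
      ∃ w, cs.letterPerm hn w (top hn) = (⟨m, by omega⟩, 1) := by
    intro d
    induction d with
    | zero =>
      intro m h
      exact ⟨1, by simp only [map_one, Equiv.Perm.one_apply, top]; congr; omega⟩
    | succ d ih =>
      intro m h
      have := step ⟨m + 1, by omega⟩ _ (ih (m + 1) (by omega))
      rw [← target_of_ne_zero hn (i := ⟨m + 1, by omega⟩) (by simp), reflectFun_right,
        source_of_ne_zero (by simp)] at this
      exact this
  have neg : ∀ m : ℕ, ∀ h : m < n,
      ∃ w, cs.letterPerm hn w (top hn) = opp (⟨m, h⟩, 1) := by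
    intro m
    induction m with
    | zero =>
      intro h
      have := step ⟨0, h⟩ _ (pos (n - 2) 1 (by omega))
      rwa [← target_zero hn h, reflectFun_right, source_zero] at this
    | succ m ih =>
      intro h
      have := step ⟨m + 1, h⟩ _ (ih (by omega))
      rw [reflectFun_opp (source_fst_ne_target_fst hn _), target_of_ne_zero hn (by simp),
        source_of_ne_zero (by simp)] at this
      simp only [Nat.add_sub_cancel, reflectFun_left] at this
      exact this
  obtain ⟨⟨m, hm⟩, ε⟩ := p
  rcases Int.units_eq_one_or ε with rfl | rfl
  · exact pos (n - 1 - m) m (by omega)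
  · exact neg m hm

/-- A shortest w with w e_n = p works: s_1, …, s_{n-1} fix e_n, so none of them can shorten w. -/
lemma exists_mem_transversalD_letterPerm_top_eq (p : SignedLetter n) :
    ∃ u ∈ cs.transversalD (n - 1), cs.letterPerm hn u (top hn) = p := by
  obtain ⟨u, hu, hmin⟩ := exists_minimal_of_wellFoundedLT
    (fun l ↦ ∃ w, cs.letterPerm hn w (top hn) = p ∧ cs.length w = l)
    (let ⟨w, hw⟩ := cs.exists_letterPerm_top_eq hn p; ⟨_, w, hw, rfl⟩)
  obtain ⟨w, hw, rfl⟩ := hu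
  refine ⟨w, fun i hi ↦ ?_, hw⟩
  have hi' : (i : ℕ) < n - 1 := hi.2
  have hfix : reflectFun (source i) (target hn i) (top hn) = top hn := by
    refine reflectFun_of_ne ?_ ?_
    · simp only [source, top, ne_eq, Fin.ext_iff]
      omega
    · simp only [target, top, ne_eq, Fin.ext_iff, apply_ite Fin.val]
      split_ifs <;> omega
  have := hmin (y := cs.length (w * cs.simple i))
    ⟨_, by rw [map_mul, Equiv.Perm.mul_apply, letterPerm_simple, hfix, hw], rfl⟩
  have := cs.length_mul_simple_ne w i
  omega

/-- The minimal coset representatives of the parabolic subgroup of type `D (n - 1)` correspond to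
the letters. -/
noncomputable def transversalEquiv : cs.transversalD (n - 1) ≃ SignedLetter n :=
  Equiv.ofBijective (fun u ↦ cs.letterPerm hn u (top hn))
    ⟨fun u u' h ↦ Subtype.ext (eq_of_letterPerm_top_eq hn u.2 u'.2 h),
      fun p ↦ let ⟨u, hu, h⟩ := cs.exists_mem_transversalD_letterPerm_top_eq hn p; ⟨⟨u, hu⟩, h⟩⟩

end

end CoxeterSystem

/-! ### Deformed falling factorials -/

/-- The product formula for the deformed falling factorials `X (X - 2) ⋯ (X - 2 (m - 1))`. -/
lemma fallingFactorial_mul_fallingFactorial {A : Type*} [Ring A] [Algebra ℚ A] {X : A} {P : ℕ → A}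
    (h0 : P 0 = 1) (hP : ∀ m : ℕ, X * P m = P (m + 1) + ((2 * m : ℕ) : ℚ) • P m) (a b : ℕ) :
    P a * P b = ∑ i ∈ Finset.range (b + 1),
      ((a.choose i * b.choose i * i ! * 2 ^ i : ℕ) : ℚ) • P (a + b - i) := by
  induction a with
  | zero =>
    rw [Finset.sum_eq_single 0 (fun i _ hi ↦ by
      rw [Nat.choose_eq_zero_of_lt (Nat.pos_of_ne_zero hi)]; simp) (by simp)]
    simp [h0]
  | succ a ih =>
    have e : P (a + 1) = X * P a - ((2 * a : ℕ) : ℚ) • P a := by rw [hP]; abel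
    have hE : ∀ i, i ≤ b → b.choose (i + 1) * (i + 1)! * 2 ^ (i + 1) =
        2 * (b - i) * (b.choose i * i ! * 2 ^ i) := by
      intro i _
      have := Nat.choose_succ_right_eq b i
      rw [Nat.factorial_succ, pow_succ]
      linear_combination (2 * i ! * 2 ^ i) * this
    -- (X - 2a) P_{a+b-i} = P_{a+b-i+1} + 2(b-i) P_{a+b-i}; the factor 2(b-i) turns the coefficient
    -- into the one with b-index i + 1, and Pascal's rule in a then merges the two sums.
    have step : ∀ i ∈ Finset.range (b + 1),
        X * ((a.choose i * b.choose i * i ! * 2 ^ i : ℕ) : ℚ) • P (a + b - i) -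
          ((2 * a : ℕ) : ℚ) • ((a.choose i * b.choose i * i ! * 2 ^ i : ℕ) : ℚ) • P (a + b - i) =
        ((a.choose i * b.choose i * i ! * 2 ^ i : ℕ) : ℚ) • P (a + 1 + b - i) +
          ((a.choose i * b.choose (i + 1) * (i + 1)! * 2 ^ (i + 1) : ℕ) : ℚ) •
            P (a + 1 + b - (i + 1)) := by
      intro i hi
      have hi' : i ≤ b := by simpa [Nat.lt_succ_iff] using hi
      have e1 : a + 1 + b - i = a + b - i + 1 := by omega
      have e2 : a + 1 + b - (i + 1) = a + b - i := by omega
      rw [mul_smul_comm, hP, e1, e2, smul_add, add_sub_assoc]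
      congr 1
      rw [smul_smul, smul_smul, ← sub_smul]
      congr 1
      have h3 := congrArg (Nat.cast (R := ℚ)) (hE i hi')
      rw [mul_assoc (a.choose i), mul_assoc (a.choose i), mul_assoc (a.choose i),
        mul_assoc (a.choose i), Nat.cast_mul (a.choose i), Nat.cast_mul (a.choose i), h3]
      push_cast [Nat.cast_sub hi', Nat.cast_sub (show i ≤ a + b by omega)]
      ring
    rw [e, sub_mul, mul_assoc, smul_mul_assoc, ih, Finset.mul_sum, Finset.smul_sum,
      ← Finset.sum_sub_distrib, Finset.sum_congr rfl step, Finset.sum_add_distrib]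
    have h2 : ∑ i ∈ Finset.range (b + 1),
        ((a.choose i * b.choose (i + 1) * (i + 1)! * 2 ^ (i + 1) : ℕ) : ℚ) •
          P (a + 1 + b - (i + 1)) =
        ∑ i ∈ Finset.range b,
        ((a.choose i * b.choose (i + 1) * (i + 1)! * 2 ^ (i + 1) : ℕ) : ℚ) •
          P (a + 1 + b - (i + 1)) := by
      rw [Finset.sum_range_succ, Nat.choose_succ_self]
      simp
    rw [h2, Finset.sum_range_succ', Finset.sum_range_succ' _ b, add_right_comm,
      ← Finset.sum_add_distrib]
    congr 1
    · refine Finset.sum_congr rfl fun i _ ↦ ?_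
      rw [← add_smul, Nat.choose_succ_succ' a i]
      congr 1
      push_cast
      ring
    · simp

/-! ### The recursion for multiplication by x_{n-1} -/

namespace CoxeterSystem

open SignedLetter

variable {n : ℕ} {W : Type*} [Group W]
variable (cs : CoxeterSystem (coxeterMatrixD n) W) (hn : 3 ≤ n)

lemma descentElementD_zero : descentElementD cs 0 = (2 : ℚ) • descentElementD cs 1 := by
  simp only [descentElementD]
  rw [two_mul, two_smul]

lemma descentElementD_eq_descentElement {k : ℕ} (hk : 1 ≤ k) :
    descentElementD cs k = cs.descentElement {i : Fin n | 2 ≤ k ∧ (i : ℕ) < k} := by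
  match k, hk with
  | 1, _ => simp [descentElementD]
  | k + 2, _ => simp [descentElementD]

section

variable [Fintype W]

open scoped Classical in
lemma descentElement_eq_sum (J : Set (Fin n)) : cs.descentElement J =
    ∑ w : W, (if w ∈ cs.leftTransversal J then (1 : ℚ) else 0) • MonoidAlgebra.of ℚ W w := by
  rw [descentElement, finsum_mem_def, finsum_eq_sum_of_fintype]
  refine Finset.sum_congr rfl fun w _ ↦ ?_
  simp only [Set.indicator_apply, ite_smul, one_smul, zero_smul]

open scoped Classical in
lemma descentElementD_eq_sum {k : ℕ} (hk : 1 ≤ k) : descentElementD cs k =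
    ∑ w : W, (if w ∈ cs.transversalD k then (1 : ℚ) else 0) • MonoidAlgebra.of ℚ W w := by
  rw [descentElementD_eq_descentElement cs hk, descentElement_eq_sum]
  rfl

open scoped Classical in
lemma descentElementD_mul_eq_sum {j k : ℕ} (hj : 1 ≤ j) (hk : 1 ≤ k) :
    descentElementD cs j * descentElementD cs k =
      ∑ w : W, (∑ u : cs.transversalD j, if (u : W)⁻¹ * w ∈ cs.transversalD k then (1 : ℚ) else 0) •
        MonoidAlgebra.of ℚ W w := by
  have hj' : descentElementD cs j = ∑ u : cs.transversalD j, MonoidAlgebra.of ℚ W (u : W) := by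
    rw [descentElementD_eq_sum cs hj]
    simp only [ite_smul, one_smul, zero_smul]
    rw [← Finset.sum_filter]
    exact Finset.sum_subtype _ (by simp) _
  rw [hj', descentElementD_eq_sum cs hk, Finset.sum_mul]
  simp only [Finset.sum_smul]
  rw [Finset.sum_comm]
  refine Finset.sum_congr rfl fun u _ ↦ ?_
  rw [Finset.mul_sum, ← Equiv.sum_comp (Equiv.mulLeft (u : W)⁻¹)]
  refine Finset.sum_congr rfl fun w _ ↦ ?_
  rw [Equiv.coe_mulLeft, mul_smul_comm, ← map_mul, mul_inv_cancel_left]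

open scoped Classical in
include hn in
-- As u runs over X_{n-1}, the letter w⁻¹u e_n takes every value exactly once.
lemma sum_transversalD_pred (w : W) (f : SignedLetter n → ℚ) :
    ∑ u : cs.transversalD (n - 1), f ((cs.letterPerm hn w)⁻¹ (cs.letterPerm hn u (top hn))) =
      ∑ p, f p :=
  ((transversalEquiv cs hn).trans (cs.letterPerm hn w)⁻¹).sum_comp f

end

lemma card_filter_le_fst {k : ℕ} (hk : k ≤ n) :
    (Finset.univ.filter fun p : SignedLetter n ↦ k ≤ (p.1 : ℕ)).card = 2 * (n - k) := by
  have h1 : (Finset.univ.filter fun p : SignedLetter n ↦ k ≤ (p.1 : ℕ)) =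
      (Finset.univ.filter fun i : Fin n ↦ k ≤ (i : ℕ)) ×ˢ (Finset.univ : Finset ℤˣ) := by
    ext
    simp only [Finset.mem_filter, Finset.mem_univ, true_and, Finset.mem_product, and_true]
  have h2 : (Finset.univ.filter fun i : Fin n ↦ (i : ℕ) < k).card = k := by
    rw [Fin.card_filter_val_lt, min_eq_right hk]
  have h3 := Finset.card_filter_add_card_filter_not (s := (Finset.univ : Finset (Fin n)))
    (fun i ↦ (i : ℕ) < k)
  simp only [not_lt, h2, Finset.card_univ, Fintype.card_fin] at h3
  rw [h1, Finset.card_product, Finset.card_univ, Fintype.card_units_int]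
  omega

include hn in
lemma descentElementD_pred_mul {k : ℕ} (hk : 1 ≤ k) (hkn : k ≤ n) :
    descentElementD cs (n - 1) * descentElementD cs k =
      ((2 * (n - k) : ℕ) : ℚ) • descentElementD cs k + descentElementD cs (k - 1) := by
  classical
  have := cs.finite_of_coxeterMatrixD hn
  have := Fintype.ofFinite W
  rw [descentElementD_mul_eq_sum cs (by omega) hk]
  rcases (by omega : k = 1 ∨ 2 ≤ k) with rfl | hk2
  -- For k = 1 all 2n letters count, and 2n = 2(n-1) + 2, where the last 2 is x_0 = 2x_1.
  · rw [Nat.sub_self, descentElementD_zero, ← add_smul, descentElementD_eq_sum cs le_rfl, Finset.smul_sum]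
    refine Finset.sum_congr rfl fun w _ ↦ ?_
    simp only [mem_transversalD_one, if_true, smul_smul]
    rw [sum_transversalD_pred cs hn w fun _ ↦ 1]
    congr 1
    simp [Nat.cast_sub (show 1 ≤ n by omega)]
    ring
  · rw [descentElementD_eq_sum cs hk, descentElementD_eq_sum cs (k := k - 1) (by omega),
      Finset.smul_sum, ← Finset.sum_add_distrib]
    refine Finset.sum_congr rfl fun w _ ↦ ?_
    rw [smul_smul, ← add_smul]
    congr 1
    have h1 (u : cs.transversalD (n - 1)) := mem_transversalD_iff_of_mul hn u.2
      (v := (u : W)⁻¹ * w) (p := (cs.letterPerm hn w)⁻¹ (cs.letterPerm hn u (top hn)))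
      (by simp) hk2 hkn
    simp only [mul_inv_cancel_left] at h1
    simp only [h1]
    rw [sum_transversalD_pred cs hn w fun p ↦ if (k ≤ (p.1 : ℕ) ∧ w ∈ cs.transversalD k) ∨
      (p = (⟨k - 1, by omega⟩, 1) ∧ w ∈ cs.transversalD (k - 1)) then 1 else 0]
    have h2 (p : SignedLetter n) : (if (k ≤ (p.1 : ℕ) ∧ w ∈ cs.transversalD k) ∨
          (p = (⟨k - 1, by omega⟩, 1) ∧ w ∈ cs.transversalD (k - 1)) then (1 : ℚ) else 0) =
        (if k ≤ (p.1 : ℕ) then 1 else 0) * (if w ∈ cs.transversalD k then 1 else 0) +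
        (if p = (⟨k - 1, by omega⟩, 1) then 1 else 0) *
          (if w ∈ cs.transversalD (k - 1) then 1 else 0) := by
      by_cases hp : p = (⟨k - 1, by omega⟩, 1)
      · have : ¬ k ≤ k - 1 := by omega
        simp [hp, this]
      · simp only [hp, false_and, or_false, if_false, add_zero, ite_and, mul_ite, mul_one,
          mul_zero, ite_self]
        split_ifs <;> rfl
    rw [Finset.sum_congr rfl fun p _ ↦ h2 p, Finset.sum_add_distrib, ← Finset.sum_mul,
      ← Finset.sum_mul, Finset.sum_boole, card_filter_le_fst hkn]
    simp

include hn in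
lemma descentElementD_self : descentElementD cs n = 1 := by
  have := cs.finite_of_coxeterMatrixD hn
  have := Fintype.ofFinite W
  classical
  rw [descentElementD_eq_sum cs (by omega), Finset.sum_eq_single 1]
  · rw [if_pos, one_smul, map_one]
    rw [mem_transversalD_iff cs hn]
    exact fun i _ _ ↦ (rootHeight_pos_iff cs hn).1 (cs.rootHeight_one hn i)
  · intro w _ hw
    rw [if_neg, zero_smul]
    intro h
    rw [mem_transversalD_iff cs hn] at h
    exact hw (cs.eq_one_of_rootHeight_pos hn fun i ↦
      (rootHeight_pos_iff cs hn).2 (h i (by omega) i.2))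
  · simp

/-! ### The product formula -/

/-- The elements `x_{n - m}`, continued by `0` for `n < m`. -/
noncomputable def descentElementDCompl (cs : CoxeterSystem (coxeterMatrixD n) W) (m : ℕ) :
    MonoidAlgebra ℚ W :=
  if m ≤ n then descentElementD cs (n - m) else 0

include hn in
-- Continuation by 0 is consistent because x_0, a multiple of x_1, satisfies X x_0 = 2n x_0.
lemma descentElementD_pred_mul_descentElementDCompl (m : ℕ) :
    descentElementD cs (n - 1) * cs.descentElementDCompl m =
      cs.descentElementDCompl (m + 1) + ((2 * m : ℕ) : ℚ) • cs.descentElementDCompl m := by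
  simp only [descentElementDCompl]
  rcases lt_trichotomy m n with h | rfl | h
  · rw [if_pos h.le, if_pos (by omega), cs.descentElementD_pred_mul hn (by omega) (by omega),
      Nat.sub_sub_self h.le, Nat.sub_sub, add_comm]
  · have h1 := cs.descentElementD_pred_mul hn le_rfl (by omega)
    rw [if_pos le_rfl, if_neg (by omega), Nat.sub_self, descentElementD_zero,
      mul_smul_comm, h1, Nat.sub_self, descentElementD_zero,
      zero_add, ← add_smul, smul_smul, smul_smul]
    congr 1
    push_cast [Nat.cast_sub (show 1 ≤ m by omega)]
    ring
  · rw [if_neg (by omega), if_neg (by omega)]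
    simp

include hn in
lemma descentElementD_mul_descentElementD {j k : ℕ} (hj : j ≤ n) (hk : k ≤ n) :
    descentElementD cs j * descentElementD cs k =
      ∑ l ∈ Finset.range (min j k + 1),
        (((n - j).choose (k - l) * (n - k).choose (j - l) * (n + l - (j + k))! *
          2 ^ (n + l - (j + k)) : ℕ) : ℚ) • descentElementD cs l := by
  have h := fallingFactorial_mul_fallingFactorial (P := cs.descentElementDCompl)
    (by simp [descentElementDCompl, cs.descentElementD_self hn])
    (cs.descentElementD_pred_mul_descentElementDCompl hn) (n - j) (n - k)
  have hcompl {l : ℕ} (hl : l ≤ n) : cs.descentElementDCompl (n - l) = descentElementD cs l := by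
    rw [descentElementDCompl, if_pos (by omega), Nat.sub_sub_self hl]
  rw [hcompl hj, hcompl hk] at h
  have hterm {l : ℕ} (hl : l ≤ min j k) (hle : j + k ≤ n + l) :
      (((n - j).choose (k - l) * (n - k).choose (j - l) * (n + l - (j + k))! *
        2 ^ (n + l - (j + k)) : ℕ) : ℚ) • descentElementD cs l =
      (((n - j).choose (n + l - (j + k)) * (n - k).choose (n + l - (j + k)) *
        (n + l - (j + k))! * 2 ^ (n + l - (j + k)) : ℕ) : ℚ) •
          cs.descentElementDCompl (n - j + (n - k) - (n + l - (j + k))) := by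
    rw [show n - j + (n - k) - (n + l - (j + k)) = n - l by omega, hcompl (by omega),
      Nat.choose_symm_of_eq_add (show n - j = (k - l) + (n + l - (j + k)) by omega),
      Nat.choose_symm_of_eq_add (show n - k = (j - l) + (n + l - (j + k)) by omega)]
  have hle {l : ℕ} (hne : (((n - j).choose (k - l) * (n - k).choose (j - l) *
      (n + l - (j + k))! * 2 ^ (n + l - (j + k)) : ℕ) : ℚ) • descentElementD cs l ≠ 0) :
      j + k ≤ n + l := by
    by_contra hlt
    rw [Nat.choose_eq_zero_of_lt (show n - j < k - l by omega)] at hne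
    simp at hne
  rw [h]
  symm
  -- Substitution i = n + l - j - k. Only nonzero terms are matched: where this subtraction
  -- truncates, a binomial coefficient vanishes, and indices i < n - j - k belong to some P_m with m
  -- > n, which is 0.
  refine Finset.sum_bij_ne_zero (fun l _ _ ↦ n + l - (j + k)) ?_ ?_ ?_ ?_
  all_goals simp only [Finset.mem_range]
  · intro l hl _
    omega
  · intro l hl hne l' hl' hne' e
    have := hle hne
    have := hle hne'
    omega
  · intro i hi hne
    have h1 : i ≤ n - j := by
      by_contra hlt
      rw [Nat.choose_eq_zero_of_lt (show n - j < i by omega)] at hne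
      simp at hne
    have h2 : n - j + (n - k) - i ≤ n := by
      by_contra hlt
      rw [descentElementDCompl, if_neg hlt, smul_zero] at hne
      exact hne rfl
    have e : n + (i + j + k - n) - (j + k) = i := by omega
    refine ⟨i + j + k - n, by omega, ?_, e⟩
    rw [hterm (by omega) (by omega), e]
    exact hne
  · intro l hl hne
    exact hterm (by omega) (hle hne)

include hn in
lemma descentElementD_mul_descentElementD_one {j : ℕ} (hj1 : 1 ≤ j) (hj : j ≤ n) :
    descentElementD cs j * descentElementD cs 1 =
      ((n ! : ℚ) / (j ! : ℚ) * 2 ^ (n - j)) • descentElementD cs 1 := by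
  rw [cs.descentElementD_mul_descentElementD hn hj (by omega), min_eq_right hj1,
    Finset.sum_range_succ, Finset.sum_range_one, descentElementD_zero, smul_smul, ← add_smul]
  congr 1
  obtain ⟨d, rfl⟩ : ∃ d, n = j + d := ⟨n - j, by omega⟩
  obtain ⟨i, rfl⟩ : ∃ i, j = i + 1 := ⟨j - 1, by omega⟩
  have e1 : i + 1 + d - (i + 1) = d := by omega
  have e2 : i + 1 + d - 1 = i + d := by omega
  have e3 : i + 1 + d + 1 - (i + 1 + 1) = d := by omega
  have hf : ((i + 1 + d)! : ℚ) = ((i + d + 1).choose (i + 1) * (i + 1)! * d ! : ℕ) := by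
    have := Nat.choose_mul_factorial_mul_factorial (show i + 1 ≤ i + d + 1 by omega)
    rw [show i + d + 1 - (i + 1) = d by omega] at this
    rw [this, add_right_comm]
  simp only [e1, e2, e3, Nat.sub_zero, Nat.sub_self, Nat.choose_one_right, Nat.choose_zero_right,
    Nat.add_sub_cancel, add_zero]
  rw [hf, Nat.choose_succ_succ']
  have hi : ((i + 1)! : ℚ) ≠ 0 := by positivity
  -- With d = n - j, the l = 0 term contains (d-1)!. For d = 0 the exponent truncates but the factor
  -- d kills the term; otherwise d (d-1)! = d! and the 2 from x_0 restores 2^d, so Pascal's rule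
  -- applies.
  rcases Nat.eq_zero_or_pos d with rfl | hd
  · simp [hi]
  · obtain ⟨c, rfl⟩ : ∃ c, d = c + 1 := ⟨d - 1, by omega⟩
    rw [show i + 1 + (c + 1) - (i + 1 + 1) = c by omega, Nat.factorial_succ c, pow_succ]
    push_cast
    field_simp
    ring

end CoxeterSystem

theorem mainTheorem9 (n : ℕ) (hn : 3 ≤ n) {W : Type*} [Group W]
    (cs : CoxeterSystem (coxeterMatrixD n) W) :
    Finite W ∧
    (∀ j k : ℕ, 1 ≤ j → j ≤ n → 1 ≤ k → k ≤ n →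
      descentElementD cs j * descentElementD cs k =
        ∑ l ∈ Finset.range (min j k + 1),
          (((n - j).choose (k - l) * (n - k).choose (j - l) * (n + l - (j + k))! *
            2 ^ (n + l - (j + k)) : ℕ) : ℚ) • descentElementD cs l) ∧
    (∀ j : ℕ, 1 ≤ j → j ≤ n →
      descentElementD cs j * descentElementD cs 1 =
        ((n ! : ℚ) / (j ! : ℚ) * 2 ^ (n - j)) • descentElementD cs 1) :=
  ⟨cs.finite_of_coxeterMatrixD hn,
    fun _ _ _ hj _ hk ↦ cs.descentElementD_mul_descentElementD hn hj hk,
    fun _ hj1 hj ↦ cs.descentElementD_mul_descentElementD_one hn hj1 hj⟩
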